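/- Let $k$ be an algebraically closed field of characteristic $0$, and call a family of forms $F_1,\dots,F_r\in k[x_1,\dots,x_n]$ a nonsingular system if the gradients $\nabla F_1(\mathbf{x}),\dots,\nabla F_r(\mathbf{x})$ are linearly independent for every non-zero $\mathbf{x}\in k^n$ with $F_1(\mathbf{x})=\dots=F_r(\mathbf{x})=0$. Let $Q_1,Q_2,Q_3\in k[x_1,\dots,x_n]$ be quadratic forms such that $\{Q_1,Q_2,Q_3\}$, $\{Q_1,Q_2\}$ and $\{Q_3\}$ are all nonsingular systems. Then for every integer $t$ with $3\le t\le (n-5)/2$ there is a $t$-dimensional projective linear subspace $L\subset\mathbb{P}^{n-1}$, contained in the quadric $Q_3=0$, such that $L\cap\{Q_1=Q_2=0\}$ is nonsingular, in the following sense: if $\ell_1,\dots,\ell_c$ is a minimal set of linear forms defining $L$, then $Q_1,Q_2,\ell_1,\dots,\ell_c$ is a nonsingular system. -/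

import Mathlib

/-- The gradient `∇F(x)` of a polynomial `F` in `n` variables at the point `x`. -/
noncomputable def gradAt {k : Type*} [CommRing k] {n : ℕ}
    (F : MvPolynomial (Fin n) k) (x : Fin n → k) : Fin n → k :=
  fun j => MvPolynomial.eval x (MvPolynomial.pderiv j F)

/-- A family of forms over an algebraically closed field `k` is a nonsingular system if the
gradients are linearly independent at every nonzero common zero in `k ^ n`. -/
def IsNonsingularSystem {k : Type*} [Field k] {n : ℕ} {ι : Type*}
    (F : ι → MvPolynomial (Fin n) k) : Prop :=
  ∀ x : Fin n → k, x ≠ 0 → (∀ i, MvPolynomial.eval x (F i) = 0) →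
    LinearIndependent k (fun i => gradAt (F i) x)

/-- `ℓ` is a minimal system of linear forms defining the linear space `L`. -/
structure IsMinimalEquations {k : Type*} [Field k] {n c : ℕ}
    (ℓ : Fin c → MvPolynomial (Fin n) k) (L : Submodule k (Fin n → k)) : Prop where
  linear : ∀ j, (ℓ j).IsHomogeneous 1
  independent : LinearIndependent k ℓ
  mem_iff : ∀ x, x ∈ L ↔ ∀ j, MvPolynomial.eval x (ℓ j) = 0

/-- `fano Q t` is the set of `t`-planes in projective `(n-1)`-space, i.e. of
`(t + 1)`-dimensional linear subspaces of `k ^ n`, which lie in the quadric `Q = 0`. -/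
def fano {k : Type*} [Field k] {n : ℕ} (Q : MvPolynomial (Fin n) k) (t : ℕ) :
    Set (Submodule k (Fin n → k)) :=
  {L | Module.finrank k L = t + 1 ∧ ∀ x ∈ L, MvPolynomial.eval x Q = 0}

/-- The section of `F₁ = F₂ = 0` by the linear space `L` is nonsingular: the forms `F₁`, `F₂`
together with a minimal set of linear forms defining `L` are a nonsingular system. Two minimal
sets differ by an invertible linear substitution, so the choice does not matter. -/
def IsNonsingularSection {k : Type*} [Field k] {n : ℕ}
    (L : Submodule k (Fin n → k)) (F₁ F₂ : MvPolynomial (Fin n) k) : Prop :=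
  ∃ (c : ℕ) (ℓ : Fin c → MvPolynomial (Fin n) k),
    IsMinimalEquations ℓ L ∧ IsNonsingularSystem (Sum.elim ![F₁, F₂] ℓ)

open Matrix TensorProduct

/-! This is Kleiman transversality for the orthogonal group of `Q₃`, made explicit by the Cayley
transform. Let `S` be the Gram matrix of `Q₃` and let the columns of `E` span a totally isotropic
space. For skew `A = Z - Zᵀ` the isometry `(S - A)⁻¹ (S + A)` moves that space inside the quadric,
and a general `Z` is claimed to work (`exists_cayley_transversal`).

If every admissible `Z` fails, choosing a tangency for each one gives a tangency over the ring of
functions of `Z`, hence over a field `F` formally étale over `k[Z]`, to which the derivations `∂/∂Z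
i j` extend. Differentiating the equations there (`IsTangency.exists_gradient_eq_smul`) forces the
gradient of `a Q₁ + b Q₂` at `y` to be a multiple of that of `Q₃`. Specialising `F` to `k`
contradicts the nonsingularity of `{Q₁, Q₂, Q₃}`. -/

/-! ### Points of finitely generated algebras and extension of derivations. -/

theorem exists_algHom_of_finiteType (k : Type*) [Field k] [IsAlgClosed k] (A : Type*) [CommRing A]
    [Nontrivial A] [Algebra k A] [Algebra.FiniteType k A] : Nonempty (A →ₐ[k] k) := by
  obtain ⟨m, hm⟩ := Ideal.exists_maximal A
  let _ := Ideal.Quotient.field m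
  have : Module.Finite k (A ⧸ m) := finite_of_finite_type_of_isJacobsonRing k (A ⧸ m)
  let e := AlgEquiv.ofBijective (Algebra.ofId k (A ⧸ m))
    (IsAlgClosed.algebraMap_bijective_of_isIntegral (k := k) (K := A ⧸ m))
  exact ⟨e.symm.toAlgHom.comp (Ideal.Quotient.mkₐ k m)⟩

/-- A residue field of the generic fibre is finite over `Frac R` by the Nullstellensatz, and
separable in characteristic zero; localisation is formally étale too. -/
theorem exists_etale_field_of_finiteType.{u, v} (R : Type u) [CommRing R] [IsDomain R] [CharZero R]
    (B : Type v) [CommRing B] [Algebra R B] [Algebra.FiniteType R B]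
    (hB : Function.Injective (algebraMap R B)) :
    ∃ (F : Type (max u v)) (_ : Field F) (_ : Algebra R F), Algebra.FormallyEtale R F ∧
      Function.Injective (algebraMap R F) ∧ Nonempty (B →ₐ[R] F) := by
  let K := FractionRing R
  have : Nontrivial (K ⊗[R] B) :=
    (Algebra.TensorProduct.includeLeft_injective (S := R) (A := K) (B := B) hB).nontrivial
  obtain ⟨m, hm⟩ := Ideal.exists_maximal (K ⊗[R] B)
  let _ := Ideal.Quotient.field m
  have : Module.Finite K ((K ⊗[R] B) ⧸ m) := finite_of_finite_type_of_isJacobsonRing _ _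
  have : CharZero K := IsFractionRing.charZero_of_isFractionRing R
  have : Algebra.FormallyEtale R K := Algebra.FormallyEtale.of_isLocalization (nonZeroDivisors R)
  have : Algebra.FormallyEtale K ((K ⊗[R] B) ⧸ m) := Algebra.FormallyEtale.of_isSeparable _ _
  refine ⟨(K ⊗[R] B) ⧸ m, inferInstance, inferInstance, Algebra.FormallyEtale.comp R K _, ?_,
    ⟨(Ideal.Quotient.mkₐ R m).comp Algebra.TensorProduct.includeRight⟩⟩
  rw [IsScalarTower.algebraMap_eq R K]
  exact (algebraMap K _).injective.comp (IsFractionRing.injective R K)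

theorem Derivation.exists_extension_of_formallyEtale {k R F : Type*} [CommRing k] [CommRing R]
    [CommRing F] [Algebra k R] [Algebra k F] [Algebra R F] [IsScalarTower k R F]
    [Algebra.FormallyEtale R F] (D : Derivation k R R) :
    ∃ D' : Derivation k F F, ∀ r, D' (algebraMap R F r) = algebraMap R F (D r) := by
  let φ : F ⊗[R] Ω[R⁄k] →ₗ[F] F :=
    LinearMap.liftBaseChange F ((Algebra.linearMap R F).comp D.liftKaehlerDifferential)
  refine ⟨(φ.comp
    (KaehlerDifferential.tensorKaehlerEquivOfFormallyEtale k R F).symm.toLinearMap).compDer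
      (KaehlerDifferential.D k F), fun r => ?_⟩
  simp [KaehlerDifferential.tensorKaehlerEquivOfFormallyEtale_symm_D_algebraMap, φ]

/-! ### Tangency as a system of polynomial equations. -/

/-- The points `y` of the Cayley translate `(S - A)⁻¹ (S + A) (im E)`, `A = Z - Zᵀ`, at which
`S₁ = S₂ = 0` and the form `a S₁ + b S₂` is tangent to the translate, with witnesses `d`, `e₁`,
`e₂` for `y ≠ 0` and `(a, b) ≠ 0`. -/
structure IsTangency {k ι κ A : Type*} [CommRing k] [Fintype ι] [Fintype κ] [CommRing A]
    [Algebra k A] (S S₁ S₂ : Matrix ι ι k) (E : Matrix ι κ k) (Z : Matrix ι ι A)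
    (c : κ → A) (y d z : ι → A) (a b e₁ e₂ : A) : Prop where
  translate : (S.map (algebraMap k A) - (Z - Zᵀ)) *ᵥ y
    - (S.map (algebraMap k A) + (Z - Zᵀ)) *ᵥ (E.map (algebraMap k A) *ᵥ c) = 0
  gradient : (S.map (algebraMap k A) + (Z - Zᵀ)) *ᵥ z
    - (a • S₁.map (algebraMap k A) *ᵥ y + b • S₂.map (algebraMap k A) *ᵥ y) = 0
  tangent : (E.map (algebraMap k A))ᵀ *ᵥ ((S.map (algebraMap k A) - (Z - Zᵀ)) *ᵥ z) = 0
  zero₁ : y ⬝ᵥ S₁.map (algebraMap k A) *ᵥ y = 0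
  zero₂ : y ⬝ᵥ S₂.map (algebraMap k A) *ᵥ y = 0
  point_ne : y ⬝ᵥ d - 1 = 0
  coeff_ne : a * e₁ + b * e₂ - 1 = 0

theorem IsTangency.map {k ι κ A B : Type*} [CommRing k] [Fintype ι]
    [Fintype κ] [CommRing A] [Algebra k A] [CommRing B] [Algebra k B] (f : A →ₐ[k] B)
    {S S₁ S₂ : Matrix ι ι k} {E : Matrix ι κ k} {Z : Matrix ι ι A}
    {c : κ → A} {y d z : ι → A} {a b e₁ e₂ : A}
    (h : IsTangency S S₁ S₂ E Z c y d z a b e₁ e₂) :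
    IsTangency S S₁ S₂ E (Z.map f) (f ∘ c) (f ∘ y) (f ∘ d) (f ∘ z) (f a) (f b) (f e₁) (f e₂) := by
  obtain ⟨h₁, h₂, h₃, h₄, h₅, h₆, h₇⟩ := h
  constructor
  · ext i
    simpa [-mulVec_mulVec, mulVec, dotProduct] using congrArg f (congrFun h₁ i)
  · ext i
    simpa [mulVec, dotProduct] using congrArg f (congrFun h₂ i)
  · ext i
    simpa [mulVec, dotProduct] using congrArg f (congrFun h₃ i)
  · simpa [mulVec, dotProduct] using congrArg f h₄
  · simpa [mulVec, dotProduct] using congrArg f h₅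
  · simpa [mulVec, dotProduct] using congrArg f h₆
  · simpa [mulVec, dotProduct] using congrArg f h₇

/-- Equations descend along jointly injective maps: this serves both for a subalgebra and for the
evaluations of a ring of functions. -/
theorem IsTangency.of_forall_map {k ι κ A Ω : Type*} {B : Ω → Type*} [CommRing k] [Fintype ι]
    [Fintype κ] [CommRing A] [Algebra k A] [∀ ω, CommRing (B ω)] [∀ ω, Algebra k (B ω)]
    (f : ∀ ω, A →ₐ[k] B ω) (hf : ∀ x, (∀ ω, f ω x = 0) → x = 0)
    {S S₁ S₂ : Matrix ι ι k} {E : Matrix ι κ k} {Z : Matrix ι ι A}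
    {c : κ → A} {y d z : ι → A} {a b e₁ e₂ : A}
    (h : ∀ ω, IsTangency S S₁ S₂ E (Z.map (f ω)) (f ω ∘ c) (f ω ∘ y) (f ω ∘ d) (f ω ∘ z)
        (f ω a) (f ω b) (f ω e₁) (f ω e₂)) :
    IsTangency S S₁ S₂ E Z c y d z a b e₁ e₂ := by
  constructor
  · ext i
    exact hf _ fun ω => by
      simpa [-mulVec_mulVec, mulVec, dotProduct] using congrFun (h ω).translate i
  · ext i
    exact hf _ fun ω => by simpa [mulVec, dotProduct] using congrFun (h ω).gradient i
  · ext i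
    exact hf _ fun ω => by simpa [mulVec, dotProduct] using congrFun (h ω).tangent i
  · exact hf _ fun ω => by simpa [mulVec, dotProduct] using (h ω).zero₁
  · exact hf _ fun ω => by simpa [mulVec, dotProduct] using (h ω).zero₂
  · exact hf _ fun ω => by simpa [mulVec, dotProduct] using (h ω).point_ne
  · exact hf _ fun ω => by simpa [mulVec, dotProduct] using (h ω).coeff_ne

/-! ### Cayley transform identities and the differentiation argument. -/

theorem Derivation.map_dotProduct {k F ι : Type*} [CommRing k] [CommRing F] [Algebra k F]
    [Fintype ι] (D : Derivation k F F) (u v : ι → F) :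
    D (u ⬝ᵥ v) = (D ∘ u) ⬝ᵥ v + u ⬝ᵥ (D ∘ v) := by
  simp [dotProduct, Finset.sum_add_distrib, mul_comm, add_comm]

theorem Derivation.map_mulVec {k F ι κ : Type*} [CommRing k] [CommRing F] [Algebra k F]
    [Fintype κ] (D : Derivation k F F) (M : Matrix ι κ F) (v : κ → F) :
    D ∘ (M *ᵥ v) = M.map D *ᵥ v + M *ᵥ (D ∘ v) := by
  ext i
  exact D.map_dotProduct _ _

theorem Derivation.map_map_algebraMap {k F ι κ : Type*} [CommRing k] [CommRing F] [Algebra k F]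
    (D : Derivation k F F) (M : Matrix ι κ k) : (M.map (algebraMap k F)).map D = 0 := by
  ext
  simp

theorem exists_smul_eq_of_mul_eq_mul {F ι : Type*} [Field F] {z w : ι → F} (hw : w ≠ 0)
    (h : ∀ i j, z i * w j = z j * w i) : ∃ μ : F, z = μ • w := by
  obtain ⟨j, hj⟩ := Function.ne_iff.1 hw
  refine ⟨z j / w j, ?_⟩
  ext i
  have := h i j
  simp only [Pi.zero_apply] at hj
  simp only [Pi.smul_apply, smul_eq_mul]
  field_simp
  exact this

theorem cayley_flip {F ι : Type*} [CommRing F] [Fintype ι] {S Z : Matrix ι ι F}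
    (hS : Sᵀ = S) (u v : ι → F) : u ⬝ᵥ (S - (Z - Zᵀ)) *ᵥ v = ((S + (Z - Zᵀ)) *ᵥ u) ⬝ᵥ v := by
  have ht : (S - (Z - Zᵀ))ᵀ = S + (Z - Zᵀ) := by
    rw [transpose_sub, transpose_sub, transpose_transpose, hS]
    abel
  rw [dotProduct_mulVec, ← mulVec_transpose, ht]

theorem cayley_flip' {F ι : Type*} [CommRing F] [Fintype ι] {S Z : Matrix ι ι F}
    (hS : Sᵀ = S) (u v : ι → F) : u ⬝ᵥ (S + (Z - Zᵀ)) *ᵥ v = ((S - (Z - Zᵀ)) *ᵥ u) ⬝ᵥ v := by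
  rw [dotProduct_comm, ← cayley_flip hS, dotProduct_comm]

theorem cayley_add_mulVec {F ι : Type*} [CommRing F] [Fintype ι] {S Z : Matrix ι ι F}
    {x y : ι → F} (h : (S - (Z - Zᵀ)) *ᵥ y = (S + (Z - Zᵀ)) *ᵥ x) :
    (S + (Z - Zᵀ)) *ᵥ (y + x) = (2 : F) • S *ᵥ y := by
  rw [mulVec_add, ← h, ← add_mulVec, ← smul_mulVec]
  congr 1
  rw [two_smul]
  abel

theorem cayley_sub_mulVec {F ι : Type*} [CommRing F] [Fintype ι] {S Z : Matrix ι ι F}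
    {x y : ι → F} (h : (S - (Z - Zᵀ)) *ᵥ y = (S + (Z - Zᵀ)) *ᵥ x) :
    (S - (Z - Zᵀ)) *ᵥ (y + x) = (2 : F) • S *ᵥ x := by
  rw [mulVec_add, h, ← add_mulVec, ← smul_mulVec]
  congr 1
  rw [two_smul]
  abel

/-- The Cayley transform preserves the quadratic form. -/
theorem cayley_quadratic {F ι : Type*} [Field F] [CharZero F] [Fintype ι] {S Z : Matrix ι ι F}
    {x y : ι → F} (hS : Sᵀ = S) (h : (S - (Z - Zᵀ)) *ᵥ y = (S + (Z - Zᵀ)) *ᵥ x) :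
    y ⬝ᵥ S *ᵥ y = x ⬝ᵥ S *ᵥ x := by
  have : y ⬝ᵥ (S + (Z - Zᵀ)) *ᵥ (y + x) = (2 : F) * (x ⬝ᵥ S *ᵥ x) := by
    rw [cayley_flip' hS, h, ← cayley_flip hS, cayley_sub_mulVec h, dotProduct_smul, smul_eq_mul]
  rw [cayley_add_mulVec h, dotProduct_smul, smul_eq_mul] at this
  exact mul_left_cancel₀ two_ne_zero this

theorem mulVec_isotropic {F ι κ : Type*} [CommRing F] [Fintype ι] [Fintype κ] {S : Matrix ι ι F}
    {E : Matrix ι κ F} (hE : Eᵀ * S * E = 0) (c : κ → F) : (E *ᵥ c) ⬝ᵥ S *ᵥ (E *ᵥ c) = 0 := by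
  rw [dotProduct_comm, dotProduct_mulVec, ← mulVec_transpose, mulVec_mulVec, mulVec_mulVec,
    hE, zero_mulVec, zero_dotProduct]

/-- Put `M = S - A`, `N = S + A`, so `Mᵀ = N`. Differentiating `M y = N E c` along `∂/∂Z i j` gives
`M y' = (e_ij - e_ji) (y + E c) + N E c'`. Pairing with `z` kills the terms in `y'` and `c'`, so `z`
is proportional to `w = y + E c`, and `N w = 2 S y`. -/
theorem IsTangency.exists_gradient_eq_smul {k F ι κ : Type*} [Field k] [Field F] [CharZero F]
    [Fintype ι] [DecidableEq ι] [Fintype κ] [Algebra k F] {S S₁ S₂ : Matrix ι ι k}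
    {E : Matrix ι κ k} {Z : Matrix ι ι F}
    {c : κ → F} {y d z : ι → F} {a b e₁ e₂ : F} (hS : S.IsSymm) (hS₁ : S₁.IsSymm)
    (hS₂ : S₂.IsSymm) (hdet : S.det ≠ 0) (hE : Eᵀ * S * E = 0)
    (h : IsTangency S S₁ S₂ E Z c y d z a b e₁ e₂)
    (D : ι → ι → Derivation k F F)
    (hD : ∀ i j, Z.map (D i j) = Matrix.single i j 1) :
    y ⬝ᵥ S.map (algebraMap k F) *ᵥ y = 0 ∧ ∃ μ : F, a • S₁.map (algebraMap k F) *ᵥ y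
      + b • S₂.map (algebraMap k F) *ᵥ y + μ • S.map (algebraMap k F) *ᵥ y = 0 := by
  obtain ⟨h₁, h₂, h₃, h₄, h₅, h₆, h₇⟩ := h
  rw [sub_eq_zero] at h₁ h₂ h₆ h₇
  have hE' : (E.map (algebraMap k F))ᵀ * S.map (algebraMap k F) * E.map (algebraMap k F) = 0 := by
    have := congrArg (fun M => M.map (algebraMap k F)) hE
    simpa [Matrix.map_mul, Matrix.transpose_map] using this
  have hSt : (S.map (algebraMap k F))ᵀ = S.map (algebraMap k F) := by
    rw [← Matrix.transpose_map, hS.eq]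
  have hS₁t : (S₁.map (algebraMap k F))ᵀ = S₁.map (algebraMap k F) := by
    rw [← Matrix.transpose_map, hS₁.eq]
  have hS₂t : (S₂.map (algebraMap k F))ᵀ = S₂.map (algebraMap k F) := by
    rw [← Matrix.transpose_map, hS₂.eq]
  have hSinj : Function.Injective (S.map (algebraMap k F)).mulVec := by
    apply Matrix.mulVec_injective_of_isUnit
    rw [Matrix.isUnit_iff_isUnit_det, ← RingHom.mapMatrix_apply, ← RingHom.map_det]
    exact (isUnit_iff_ne_zero.2 hdet).map _
  have hd := fun i j => congrArg (D i j ∘ ·) h₁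
  have hd₁ := fun i j => congrArg (D i j) h₄
  have hd₂ := fun i j => congrArg (D i j) h₅
  simp only [Derivation.map_dotProduct, Derivation.map_mulVec, Derivation.map_map_algebraMap, zero_mulVec, zero_add,
    map_zero] at hd₁ hd₂
  simp only [Derivation.map_mulVec, Derivation.map_map_algebraMap, zero_mulVec, zero_add] at hd
  have hsub : ∀ i j, (S.map (algebraMap k F) - (Z - Zᵀ)).map (D i j)
      = -(Matrix.single i j 1 - Matrix.single j i 1) := by
    intro i j
    have hji : Matrix.single j i 1 = (Z.map (D i j))ᵀ := by rw [hD, transpose_single]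
    rw [hji, ← hD]
    ext
    simp
  have hadd : ∀ i j, (S.map (algebraMap k F) + (Z - Zᵀ)).map (D i j)
      = (Matrix.single i j 1 - Matrix.single j i 1) := by
    intro i j
    have hji : Matrix.single j i 1 = (Z.map (D i j))ᵀ := by rw [hD, transpose_single]
    rw [hji, ← hD]
    ext
    simp
  simp only [hsub, hadd] at hd
  generalize S.map (algebraMap k F) = S' at *
  generalize S₁.map (algebraMap k F) = S₁' at *
  generalize S₂.map (algebraMap k F) = S₂' at *
  generalize E.map (algebraMap k F) = E' at *
  have hflip := cayley_flip (Z := Z) hSt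
  have hflip' := cayley_flip' (Z := Z) hSt
  have hNw := cayley_add_mulVec h₁
  have hiso := (cayley_quadratic hSt h₁).trans (mulVec_isotropic hE' c)
  generalize S' - (Z - Zᵀ) = M at *
  generalize S' + (Z - Zᵀ) = N at *
  set w := y + E' *ᵥ c with hw
  have hy : y ≠ 0 := by
    rintro rfl
    simp at h₆
  have hw0 : w ≠ 0 := by
    intro h0
    rw [h0, mulVec_zero] at hNw
    apply hy
    apply hSinj
    simpa using hNw.symm
  have hquad : ∀ T : Matrix ι ι F, Tᵀ = T → ∀ v : ι → F,
      v ⬝ᵥ T *ᵥ y + y ⬝ᵥ T *ᵥ v = 0 → (T *ᵥ y) ⬝ᵥ v = 0 := by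
    intro T hT v hv
    have : y ⬝ᵥ T *ᵥ v = (T *ᵥ y) ⬝ᵥ v := by rw [dotProduct_mulVec, ← mulVec_transpose, hT]
    rw [this, dotProduct_comm v, ← two_mul] at hv
    simpa using hv
  refine ⟨hiso, ?_⟩
  obtain ⟨μ, hμ⟩ := exists_smul_eq_of_mul_eq_mul (z := z) hw0 (by
    intro i j
    have h0 := congrArg (z ⬝ᵥ ·) (hd i j)
    -- This is `N z`, the gradient, paired with `y'`; it vanishes since `S₁` and `S₂` stay zero
    -- along `y`.
    have e1 : z ⬝ᵥ M *ᵥ (D i j ∘ y) = 0 := by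
      rw [hflip, h₂, add_dotProduct, smul_dotProduct, smul_dotProduct,
        hquad _ hS₁t _ (hd₁ i j), hquad _ hS₂t _ (hd₂ i j)]
      simp
    have e2 : z ⬝ᵥ N *ᵥ (E' *ᵥ (D i j ∘ c)) = 0 := by
      rw [hflip', dotProduct_mulVec, ← mulVec_transpose, h₃, zero_dotProduct]
    simp only [dotProduct_add, e1, e2, add_zero, neg_mulVec, dotProduct_neg] at h0
    have : z ⬝ᵥ (Matrix.single i j 1 - Matrix.single j i 1) *ᵥ w = 0 := by
      rw [hw, mulVec_add, dotProduct_add, ← h0]; ring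
    simp only [sub_mulVec, dotProduct_sub, single_mulVec] at this
    simpa [sub_eq_zero, dotProduct, Function.update_apply] using this)
  refine ⟨-(2 * μ), ?_⟩
  rw [← h₂, hμ, mulVec_smul, hNw, smul_smul, neg_smul, mul_comm]
  simp

/-! ### Specialisation to `k` and existence of a good Cayley parameter. -/

theorem exists_finiteType_subalgebra {R F : Type*} [CommRing R] [CommRing F] [Algebra R F]
    {s : Set F} (hs : s.Finite) : ∃ B : Subalgebra R F, Algebra.FiniteType R B ∧ ∀ x ∈ s, x ∈ B :=
  ⟨Algebra.adjoin R s, Algebra.FiniteType.adjoin_of_finite hs, fun _ hx =>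
    Algebra.subset_adjoin hx⟩

/-- The witnesses `d`, `e₁`, `e₂` turn nonvanishing into equations, which survive a `k`-point of the
algebra generated by all the data. -/
theorem exists_singular_point_of_extension {k F ι : Type*} [Field k] [IsAlgClosed k] [Field F]
    [Algebra k F] [Fintype ι] (S S₁ S₂ : Matrix ι ι k) (y d : ι → F) (a b μ e₁ e₂ : F)
    (h₁ : y ⬝ᵥ S₁.map (algebraMap k F) *ᵥ y = 0) (h₂ : y ⬝ᵥ S₂.map (algebraMap k F) *ᵥ y = 0)
    (h₃ : y ⬝ᵥ S.map (algebraMap k F) *ᵥ y = 0)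
    (hgrad : a • S₁.map (algebraMap k F) *ᵥ y + b • S₂.map (algebraMap k F) *ᵥ y
      + μ • S.map (algebraMap k F) *ᵥ y = 0)
    (hd : y ⬝ᵥ d = 1) (he : a * e₁ + b * e₂ = 1) :
    ∃ (x : ι → k) (a b μ : k), x ≠ 0 ∧ ¬(a = 0 ∧ b = 0) ∧ x ⬝ᵥ S₁ *ᵥ x = 0 ∧ x ⬝ᵥ S₂ *ᵥ x = 0 ∧
      x ⬝ᵥ S *ᵥ x = 0 ∧ a • S₁ *ᵥ x + b • S₂ *ᵥ x + μ • S *ᵥ x = 0 := by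
  obtain ⟨B, _, hs⟩ := exists_finiteType_subalgebra (R := k)
    (Set.toFinite (Set.range y ∪ Set.range d ∪ {a, b, μ, e₁, e₂}))
  simp only [Set.mem_union, Set.mem_range, Set.mem_insert_iff, Set.mem_singleton_iff, or_imp,
    forall_and, forall_exists_index, forall_apply_eq_imp_iff, forall_eq] at hs
  obtain ⟨⟨hyB, hdB⟩, haB, hbB, hμB, he₁B, he₂B⟩ := hs
  obtain ⟨f⟩ := exists_algHom_of_finiteType k B
  lift y to ι → B using hyB
  lift d to ι → B using hdB
  lift a to B using haB
  lift b to B using hbB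
  lift μ to B using hμB
  lift e₁ to B using he₁B
  lift e₂ to B using he₂B
  have hinj : Function.Injective B.val := Subtype.val_injective
  have hquad : ∀ T : Matrix ι ι k, (fun i => (y i : F)) ⬝ᵥ T.map (algebraMap k F) *ᵥ
      (fun i => (y i : F)) = 0 → (f ∘ y) ⬝ᵥ T *ᵥ (f ∘ y) = 0 := by
    intro T hT
    have h : y ⬝ᵥ T.map (algebraMap k B) *ᵥ y = 0 := by
      apply hinj
      simpa [mulVec, dotProduct] using hT
    simpa [mulVec, dotProduct] using congrArg f h
  have hd' : y ⬝ᵥ d = 1 := by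
    apply hinj
    simpa [dotProduct] using hd
  have he' : a * e₁ + b * e₂ = 1 := by
    apply hinj
    simpa using he
  have hgrad' : a • S₁.map (algebraMap k B) *ᵥ y + b • S₂.map (algebraMap k B) *ᵥ y
      + μ • S.map (algebraMap k B) *ᵥ y = 0 := by
    ext i : 1
    apply hinj
    simpa [mulVec, dotProduct] using congrFun hgrad i
  refine ⟨f ∘ y, f a, f b, f μ, fun h => ?_, fun h => ?_, hquad _ h₁, hquad _ h₂, hquad _ h₃, ?_⟩
  · have := congrArg f hd'
    simp only [dotProduct, map_sum, map_mul, map_one] at this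
    simp [fun i => show f (y i) = 0 from congrFun h i] at this
  · have := congrArg f he'
    simp [h.1, h.2] at this
  · ext i
    simpa [mulVec, dotProduct] using congrArg f (congrFun hgrad' i)

theorem not_isTangency_generic {k ι κ B : Type*} [Field k] [IsAlgClosed k] [CharZero k]
    [Fintype ι] [DecidableEq ι] [Fintype κ] [CommRing B] [Algebra k B]
    [Algebra (MvPolynomial (ι × ι) k) B] [IsScalarTower k (MvPolynomial (ι × ι) k) B]
    (hB : Function.Injective (algebraMap (MvPolynomial (ι × ι) k) B))
    {S S₁ S₂ : Matrix ι ι k} {E : Matrix ι κ k} (hS : S.IsSymm) (hS₁ : S₁.IsSymm)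
    (hS₂ : S₂.IsSymm) (hdet : S.det ≠ 0) (hE : Eᵀ * S * E = 0)
    (hR : ∀ (x : ι → k) (a b μ : k), x ≠ 0 → x ⬝ᵥ S₁ *ᵥ x = 0 → x ⬝ᵥ S₂ *ᵥ x = 0 →
      x ⬝ᵥ S *ᵥ x = 0 → a • S₁ *ᵥ x + b • S₂ *ᵥ x + μ • S *ᵥ x = 0 → a = 0 ∧ b = 0)
    (c : κ → B) (y d z : ι → B) (a b e₁ e₂ : B) :
    ¬ IsTangency S S₁ S₂ E (Matrix.of fun i j =>
      algebraMap (MvPolynomial (ι × ι) k) B (MvPolynomial.X (i, j))) c y d z a b e₁ e₂ := by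
  intro h
  let R := MvPolynomial (ι × ι) k
  obtain ⟨B', _, hs⟩ := exists_finiteType_subalgebra (R := R)
    (Set.toFinite (Set.range c ∪ Set.range y ∪ Set.range d ∪ Set.range z ∪ {a, b, e₁, e₂}))
  simp only [Set.mem_union, Set.mem_range, Set.mem_insert_iff, Set.mem_singleton_iff, or_imp,
    forall_and, forall_exists_index, forall_apply_eq_imp_iff, forall_eq] at hs
  obtain ⟨⟨⟨⟨hcB, hyB⟩, hdB⟩, hzB⟩, haB, hbB, he₁B, he₂B⟩ := hs
  lift c to κ → B' using hcB
  lift y to ι → B' using hyB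
  lift d to ι → B' using hdB
  lift z to ι → B' using hzB
  lift a to B' using haB
  lift b to B' using hbB
  lift e₁ to B' using he₁B
  lift e₂ to B' using he₂B
  have h' : IsTangency S S₁ S₂ E (Matrix.of fun i j =>
      algebraMap R B' (MvPolynomial.X (i, j))) c y d z a b e₁ e₂ :=
    IsTangency.of_forall_map (Ω := Unit) (fun _ => (B'.val).restrictScalars k)
      (fun x hx => Subtype.val_injective (hx ())) (fun _ => h)
  have hB' : Function.Injective (algebraMap R B') := by
    intro x y hxy
    exact hB (congrArg Subtype.val hxy)
  obtain ⟨F, _, _, _, hF, ⟨g⟩⟩ := exists_etale_field_of_finiteType R B' hB'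
  -- With `k` acting through `R`, the extended partial derivatives are `k`-linear.
  let _ : Algebra k F := ((algebraMap R F).comp (algebraMap k R)).toAlgebra
  have : IsScalarTower k R F := .of_algebraMap_eq' rfl
  have : CharZero F := charZero_of_injective_algebraMap hF
  have hT := h'.map (g.restrictScalars k)
  choose D hD using fun i j : ι =>
    Derivation.exists_extension_of_formallyEtale (F := F) (MvPolynomial.pderiv (R := k) (i, j))
  obtain ⟨h₃, μ, hμ⟩ := hT.exists_gradient_eq_smul hS hS₁ hS₂ hdet hE D (by
    intro i j
    ext i' j'
    simp only [Matrix.map_apply, of_apply, AlgHom.restrictScalars_apply, AlgHom.commutes]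
    refine (hD i j _).trans ?_
    rw [MvPolynomial.pderiv_X, Matrix.single_apply, Pi.single_apply]
    simp only [Prod.mk.injEq, eq_comm (a := i'), eq_comm (a := j')]
    split_ifs <;> simp)
  obtain ⟨x, a, b, μ, hx, hab, h₁, h₂, h₃, hgrad⟩ := exists_singular_point_of_extension S S₁ S₂
    _ _ _ _ μ _ _ hT.zero₁ hT.zero₂ h₃ hμ (sub_eq_zero.1 hT.point_ne) (sub_eq_zero.1 hT.coeff_ne)
  exact hab (hR x a b μ hx h₁ h₂ h₃ hgrad)

theorem exists_dotProduct_eq_one {k ι : Type*} [Field k] [Fintype ι] [DecidableEq ι] {y : ι → k}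
    (hy : y ≠ 0) : ∃ d, y ⬝ᵥ d = 1 := by
  obtain ⟨i, hi⟩ := Function.ne_iff.1 hy
  exact ⟨Pi.single i (y i)⁻¹, by simpa using mul_inv_cancel₀ hi⟩

theorem exists_cayley_transversal {k ι κ : Type*} [Field k] [IsAlgClosed k] [CharZero k]
    [Fintype ι] [DecidableEq ι] [Fintype κ]
    {S S₁ S₂ : Matrix ι ι k} {E : Matrix ι κ k} (hS : S.IsSymm) (hS₁ : S₁.IsSymm)
    (hS₂ : S₂.IsSymm) (hdet : S.det ≠ 0) (hE : Eᵀ * S * E = 0)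
    (hR : ∀ (x : ι → k) (a b μ : k), x ≠ 0 → x ⬝ᵥ S₁ *ᵥ x = 0 → x ⬝ᵥ S₂ *ᵥ x = 0 →
      x ⬝ᵥ S *ᵥ x = 0 → a • S₁ *ᵥ x + b • S₂ *ᵥ x + μ • S *ᵥ x = 0 → a = 0 ∧ b = 0) :
    ∃ Z : Matrix ι ι k, (S - (Z - Zᵀ)).det ≠ 0 ∧ ∀ (c : κ → k) (y z : ι → k) (a b : k),
      (S - (Z - Zᵀ)) *ᵥ y = (S + (Z - Zᵀ)) *ᵥ (E *ᵥ c) →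
      (S + (Z - Zᵀ)) *ᵥ z = a • S₁ *ᵥ y + b • S₂ *ᵥ y →
      Eᵀ *ᵥ ((S - (Z - Zᵀ)) *ᵥ z) = 0 → y ⬝ᵥ S₁ *ᵥ y = 0 → y ⬝ᵥ S₂ *ᵥ y = 0 → y ≠ 0 →
      a = 0 ∧ b = 0 := by
  by_contra hcon
  let Ω := {Z : Matrix ι ι k // (S - (Z - Zᵀ)).det ≠ 0}
  have key : ∀ Z : Ω, ∃ (c : κ → k) (y d z : ι → k) (a b e₁ e₂ : k),
      IsTangency S S₁ S₂ E Z.1 c y d z a b e₁ e₂ := by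
    rintro ⟨Z, hZ⟩
    by_contra hno
    refine hcon ⟨Z, hZ, fun c y z a b h₁ h₂ h₃ h₄ h₅ hy => ?_⟩
    by_contra hab
    obtain ⟨d, hd⟩ := exists_dotProduct_eq_one hy
    obtain ⟨e, he⟩ := exists_dotProduct_eq_one (y := ![a, b]) (by simpa using hab)
    refine hno ⟨c, y, d, z, a, b, e 0, e 1, ?_⟩
    simp only [dotProduct, Fin.sum_univ_two, cons_val_zero, cons_val_one] at he
    exact ⟨sub_eq_zero.2 h₁, sub_eq_zero.2 h₂, h₃, h₄, h₅, sub_eq_zero.2 hd, sub_eq_zero.2 he⟩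
  choose c y d z a b e₁ e₂ h using key
  let φ : MvPolynomial (ι × ι) k →ₐ[k] (Ω → k) :=
    AlgHom.pi fun Z => MvPolynomial.aeval fun p : ι × ι => Z.1 p.1 p.2
  have hφ : ∀ r (Z : Ω), φ r Z = MvPolynomial.eval (fun p : ι × ι => Z.1 p.1 p.2) r := by
    intro r Z
    simp [φ, MvPolynomial.aeval_eq_eval]
  let _ : Algebra (MvPolynomial (ι × ι) k) (Ω → k) := φ.toRingHom.toAlgebra
  have : IsScalarTower k (MvPolynomial (ι × ι) k) (Ω → k) :=
    .of_algebraMap_eq fun x => (φ.commutes x).symm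
  refine not_isTangency_generic (B := Ω → k) ?_ hS hS₁ hS₂ hdet hE hR (fun i Z => c Z i)
    (fun i Z => y Z i) (fun i Z => d Z i) (fun i Z => z Z i) a b e₁ e₂
    (IsTangency.of_forall_map (fun Z => Pi.evalAlgHom k (fun _ : Ω => k) Z)
      (fun x hx => funext hx) fun Z => ?_)
  -- `Ω` is Zariski dense: it is the locus `P ≠ 0`, and `P` takes the value `det S` at `Z = 0`. A
  -- polynomial `r` vanishing on `Ω` thus has `r * P = 0`.
  · let G : Matrix ι ι (MvPolynomial (ι × ι) k) := Matrix.of fun i j => MvPolynomial.X (i, j)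
    let P : MvPolynomial (ι × ι) k := (S.map MvPolynomial.C - (G - Gᵀ)).det
    have hP : ∀ Z : Matrix ι ι k, MvPolynomial.eval (fun p : ι × ι => Z p.1 p.2) P
        = (S - (Z - Zᵀ)).det := by
      intro Z
      simp only [P, RingHom.map_det]
      congr 1
      ext i j
      simp [G]
    have hP0 : P ≠ 0 := by
      intro h0
      have := hP 0
      rw [h0] at this
      simp [hdet.symm] at this
    rw [injective_iff_map_eq_zero]
    intro r hr
    have : r * P = 0 := by
      apply MvPolynomial.funext
      intro x
      by_cases hx : (S - (Matrix.of (fun i j => x (i, j))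
        - (Matrix.of (fun i j => x (i, j)))ᵀ)).det = 0
      · rw [map_mul, show MvPolynomial.eval x P = _ from hP (Matrix.of fun i j => x (i, j)), hx]
        simp
      · have := congrFun hr ⟨_, hx⟩
        rw [map_mul, show MvPolynomial.eval x r = 0 from (hφ r ⟨_, hx⟩).symm.trans this]
        simp
    exact (mul_eq_zero.1 this).resolve_right hP0
  · have hZ : (Matrix.of fun i j => algebraMap (MvPolynomial (ι × ι) k) (Ω → k)
        (MvPolynomial.X (i, j))).map (Pi.evalAlgHom k (fun _ : Ω => k) Z) = Z.1 := by
      ext i j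
      exact (hφ _ Z).trans (by simp)
    rw [hZ]
    exact h Z

/-! ### Gram matrices and totally isotropic subspaces. -/

theorem exists_gram_matrix {k : Type*} [Field k] [CharZero k] {n : ℕ}
    {Q : MvPolynomial (Fin n) k} (hQ : Q.IsHomogeneous 2) :
    ∃ S : Matrix (Fin n) (Fin n) k, S.IsSymm ∧ (∀ x, MvPolynomial.eval x Q = x ⬝ᵥ S *ᵥ x) ∧
      ∀ x, gradAt Q x = (2 : k) • S *ᵥ x := by
  -- Half the Hessian, whose entries are constants; Euler's identity recovers the gradient and the
  -- form.
  let S : Matrix (Fin n) (Fin n) k := Matrix.of fun i j =>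
    2⁻¹ * MvPolynomial.constantCoeff (MvPolynomial.pderiv j (MvPolynomial.pderiv i Q))
  have h1 : ∀ i, (MvPolynomial.pderiv i Q).IsHomogeneous 1 := fun i => hQ.pderiv
  have h0 : ∀ i j x, MvPolynomial.eval x (MvPolynomial.pderiv j (MvPolynomial.pderiv i Q))
      = 2 * S i j := by
    intro i j x
    have h : (MvPolynomial.pderiv j (MvPolynomial.pderiv i Q)).IsHomogeneous 0 := (h1 i).pderiv
    rw [MvPolynomial.totalDegree_eq_zero_iff_eq_C.1 (Nat.le_zero.1 h.totalDegree_le)]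
    simp [S, MvPolynomial.constantCoeff_eq]
  have hgrad : ∀ x, gradAt Q x = (2 : k) • S *ᵥ x := by
    intro x
    ext i
    have h := congrArg (MvPolynomial.eval x) (h1 i).sum_X_mul_pderiv
    simp only [map_sum, map_mul, MvPolynomial.eval_X, h0, one_smul] at h
    rw [gradAt, ← h, Pi.smul_apply, mulVec, dotProduct, smul_eq_mul, Finset.mul_sum]
    exact Finset.sum_congr rfl fun j _ => by ring
  refine ⟨S, ?_, fun x => ?_, hgrad⟩
  · ext i j
    simp only [S, transpose_apply, of_apply, MvPolynomial.constantCoeff_eq,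
      MvPolynomial.coeff_pderiv]
    by_cases hij : i = j
    · rw [hij]
    · simp [hij, Ne.symm hij, add_comm]
  · have h := congrArg (MvPolynomial.eval x) hQ.sum_X_mul_pderiv
    simp only [map_sum, map_mul, MvPolynomial.eval_X, nsmul_eq_mul, map_natCast] at h
    have h' : ∀ i, MvPolynomial.eval x (MvPolynomial.pderiv i Q) = 2 * (S *ᵥ x) i :=
      fun i => congrFun (hgrad x) i
    simp only [h'] at h
    apply mul_left_cancel₀ (two_ne_zero (α := k))
    rw [dotProduct, Finset.mul_sum, ← Nat.cast_two, ← h]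
    exact Finset.sum_congr rfl fun j _ => by push_cast; ring

theorem exists_isotropic_of_two_le_finrank {k ι : Type*} [Field k] [IsAlgClosed k] [CharZero k]
    [Fintype ι] {S : Matrix ι ι k} (hS : S.IsSymm) (C : Submodule k (ι → k))
    (hC : 2 ≤ Module.finrank k C) : ∃ u ∈ C, u ≠ 0 ∧ u ⬝ᵥ S *ᵥ u = 0 := by
  obtain ⟨f, hf⟩ := exists_linearIndependent_of_le_finrank hC
  have hf' := hf.map' C.subtype C.ker_subtype
  set p : ι → k := (f 0 : ι → k)
  set q : ι → k := (f 1 : ι → k)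
  have hpq : ∀ s t : k, s • p + t • q = 0 → s = 0 ∧ t = 0 := by
    rw [← LinearIndependent.pair_iff]
    convert hf' using 1
    ext i : 1
    fin_cases i <;> rfl
  by_cases hq : q ⬝ᵥ S *ᵥ q = 0
  · refine ⟨q, (f 1).2, fun h => ?_, hq⟩
    simpa using (hpq 0 1 (by simp [h])).2
  have hsymm : q ⬝ᵥ S *ᵥ p = p ⬝ᵥ S *ᵥ q := by
    rw [dotProduct_mulVec, ← mulVec_transpose, hS.eq, dotProduct_comm]
  obtain ⟨r, hr⟩ := IsAlgClosed.exists_pow_nat_eq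
    (discrim (q ⬝ᵥ S *ᵥ q) (2 * (p ⬝ᵥ S *ᵥ q)) (p ⬝ᵥ S *ᵥ p)) (n := 2) two_pos
  obtain ⟨s, hs⟩ := exists_quadratic_eq_zero hq ⟨r, by rw [← hr, sq]⟩
  refine ⟨p + s • q, C.add_mem (f 0).2 (C.smul_mem _ (f 1).2), fun h => ?_, ?_⟩
  · simpa using (hpq 1 s (by simpa using h)).1
  · simp only [mulVec_add, mulVec_smul, dotProduct_add, add_dotProduct, smul_dotProduct,
      dotProduct_smul, smul_eq_mul, hsymm]
    linear_combination hs

/-- The orthogonal `ker T` of `m` isotropic vectors has dimension at least `m + 2` and contains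
their span, so a complement `C` of the span in it has dimension at least two and holds the next
isotropic vector. -/
theorem exists_linearIndependent_isotropic {k ι : Type*} [Field k] [IsAlgClosed k] [CharZero k]
    [Fintype ι] {S : Matrix ι ι k} (hS : S.IsSymm) (m : ℕ) (hm : 2 * m ≤ Fintype.card ι) :
    ∃ v : Fin m → ι → k, LinearIndependent k v ∧ ∀ i j, v i ⬝ᵥ S *ᵥ v j = 0 := by
  induction m with
  | zero => exact ⟨Fin.elim0, linearIndependent_empty_type, fun i => i.elim0⟩
  | succ m ih =>
    obtain ⟨v, hv, hiso⟩ := ih (by omega)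
    have hsymm : ∀ x y : ι → k, x ⬝ᵥ S *ᵥ y = y ⬝ᵥ S *ᵥ x := by
      intro x y
      rw [dotProduct_mulVec, ← mulVec_transpose, hS.eq, dotProduct_comm]
    let T : (ι → k) →ₗ[k] (Fin m → k) := (Matrix.of v * S).mulVecLin
    have hT : ∀ u i, T u i = v i ⬝ᵥ S *ᵥ u := by
      intro u i
      simp only [T, mulVecLin_apply, ← mulVec_mulVec]
      rfl
    let W : Submodule k (LinearMap.ker T) := (Submodule.span k (Set.range v)).comap
      (LinearMap.ker T).subtype
    have hWle : Submodule.span k (Set.range v) ≤ LinearMap.ker T := by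
      rw [Submodule.span_le]
      rintro _ ⟨j, rfl⟩
      rw [SetLike.mem_coe, LinearMap.mem_ker]
      ext i
      rw [hT, hiso, Pi.zero_apply]
    have hWdim : Module.finrank k W = m := by
      rw [(Submodule.comapSubtypeEquivOfLe hWle).finrank_eq, finrank_span_eq_card hv,
        Fintype.card_fin]
    obtain ⟨C, hC⟩ := W.exists_isCompl
    have h1 := Submodule.finrank_add_eq_of_isCompl hC
    have h2 := T.finrank_range_add_finrank_ker
    have h3 : Module.finrank k (LinearMap.range T) ≤ m :=
      (Submodule.finrank_le _).trans (by simp)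
    rw [Module.finrank_fintype_fun_eq_card] at h2
    obtain ⟨u, hu, hu0, huu⟩ := exists_isotropic_of_two_le_finrank hS
      (C.map (LinearMap.ker T).subtype) (by
        rw [Submodule.finrank_map_subtype_eq]
        omega)
    obtain ⟨u, huC, rfl⟩ := hu
    have hker : ∀ i, v i ⬝ᵥ S *ᵥ (u : ι → k) = 0 := fun i => by
      rw [← hT, LinearMap.mem_ker.1 u.2, Pi.zero_apply]
    refine ⟨Fin.cons (u : ι → k) v, hv.finCons fun hmem => ?_, fun i j => ?_⟩
    · have : u ∈ W ⊓ C := ⟨hmem, huC⟩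
      rw [hC.inf_eq_bot, Submodule.mem_bot] at this
      exact hu0 (by simp [this])
    · refine Fin.cases ?_ (fun i => ?_) i <;> refine Fin.cases ?_ (fun j => ?_) j
      · exact huu
      · simpa [hsymm (u : ι → k)] using hker j
      · simpa using hker i
      · simpa using hiso i j

/-! ### Equations of `L` and the conclusion. -/

theorem exists_minimalEquations {k : Type*} [Field k] {n : ℕ} (L : Submodule k (Fin n → k)) :
    ∃ (c : ℕ) (ℓ : Fin c → MvPolynomial (Fin n) k), IsMinimalEquations ℓ L ∧
      (∀ j x u, gradAt (ℓ j) x ⬝ᵥ u = MvPolynomial.eval u (ℓ j)) ∧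
      ∀ x, LinearIndependent k fun j => gradAt (ℓ j) x := by
  -- Coordinates on the quotient by `L` are independent forms cutting out `L`.
  let β := Module.finBasis k ((Fin n → k) ⧸ L)
  let φ : Fin _ → Module.Dual k (Fin n → k) := fun j => (β.coord j).comp L.mkQ
  let ℓ : Fin _ → MvPolynomial (Fin n) k := fun j =>
    ∑ i, MvPolynomial.C (φ j (Pi.single i 1)) * MvPolynomial.X i
  have heval : ∀ j x, MvPolynomial.eval x (ℓ j) = φ j x := by
    intro j x
    conv_rhs => rw [pi_eq_sum_univ' x]
    simp [ℓ, mul_comm]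
  have hgrad : ∀ j x u, gradAt (ℓ j) x ⬝ᵥ u = MvPolynomial.eval u (ℓ j) := by
    intro j x u
    simp [ℓ, gradAt, dotProduct, MvPolynomial.pderiv_X, Pi.single_apply]
  have hφ : ∀ g : Fin _ → k, ∑ j, g j • φ j = 0 → ∀ j, g j = 0 := by
    intro g hg j
    obtain ⟨u, hu⟩ := L.mkQ_surjective (β j)
    have := LinearMap.congr_fun hg u
    simpa [φ, LinearMap.sum_apply, -Submodule.mkQ_apply, hu, Finsupp.single_apply] using this
  refine ⟨_, ℓ, ⟨fun j => ?_, ?_, fun x => ?_⟩, hgrad, fun x => ?_⟩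
  · refine MvPolynomial.IsHomogeneous.sum _ _ _ fun i _ => ?_
    simpa using (MvPolynomial.isHomogeneous_C _ _).mul (MvPolynomial.isHomogeneous_X k i)
  · rw [Fintype.linearIndependent_iff]
    intro g hg
    refine hφ g (LinearMap.ext fun u => ?_)
    have := congrArg (MvPolynomial.eval u) hg
    simpa [MvPolynomial.smul_eval, heval] using this
  · simp only [heval]
    rw [← Submodule.Quotient.mk_eq_zero L, ← β.forall_coord_eq_zero_iff]
    rfl
  · rw [Fintype.linearIndependent_iff]
    intro g hg
    refine hφ g (LinearMap.ext fun u => ?_)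
    have := congrArg (· ⬝ᵥ u) hg
    simpa [sum_dotProduct, hgrad, heval] using this

/-- Pairing a relation among gradients with vectors of `L` removes the linear forms. -/
theorem isNonsingularSection_of_forall {k : Type*} [Field k] {n : ℕ}
    {L : Submodule k (Fin n → k)} {F₁ F₂ : MvPolynomial (Fin n) k}
    (h : ∀ x ∈ L, x ≠ 0 → MvPolynomial.eval x F₁ = 0 → MvPolynomial.eval x F₂ = 0 → ∀ a b : k,
      (∀ u ∈ L, (a • gradAt F₁ x + b • gradAt F₂ x) ⬝ᵥ u = 0) → a = 0 ∧ b = 0) :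
    IsNonsingularSection L F₁ F₂ := by
  obtain ⟨c, ℓ, hℓ, hgrad, hind⟩ := exists_minimalEquations L
  refine ⟨c, ℓ, hℓ, fun x hx hzero => ?_⟩
  rw [Fintype.linearIndependent_iff]
  intro g hg
  have hxL : x ∈ L := (hℓ.mem_iff x).2 fun j => hzero (.inr j)
  simp only [Fintype.sum_sum_type, Fin.sum_univ_two, Sum.elim_inl, Sum.elim_inr, cons_val_zero,
    cons_val_one] at hg
  obtain ⟨ha, hb⟩ := h x hxL hx (hzero (.inl 0)) (hzero (.inl 1)) (g (.inl 0)) (g (.inl 1)) (by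
    intro u hu
    have := congrArg (· ⬝ᵥ u) hg
    simpa [add_dotProduct, sum_dotProduct, hgrad, (hℓ.mem_iff u).1 hu] using this)
  rw [ha, hb, zero_smul, zero_smul, zero_add, zero_add] at hg
  have hrest := Fintype.linearIndependent_iff.1 (hind x) _ hg
  rintro (i | j)
  · fin_cases i
    exacts [ha, hb]
  · exact hrest j

theorem lemma3 {k : Type*} [Field k] [IsAlgClosed k] [CharZero k] (n : ℕ)
    (Q₁ Q₂ Q₃ : MvPolynomial (Fin n) k)
    (hQ₁ : Q₁.IsHomogeneous 2) (hQ₂ : Q₂.IsHomogeneous 2) (hQ₃ : Q₃.IsHomogeneous 2)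
    (hR : IsNonsingularSystem ![Q₁, Q₂, Q₃])
    (hQ₁₂ : IsNonsingularSystem ![Q₁, Q₂])
    (hQ₃ns : IsNonsingularSystem ![Q₃])
    (t : ℕ) (ht : 3 ≤ t) (htn : (t : ℚ) ≤ ((n : ℚ) - 5) / 2) :
    ∃ L ∈ fano Q₃ t, IsNonsingularSection L Q₁ Q₂ := by
  obtain ⟨S₁, hS₁, hev₁, hgr₁⟩ := exists_gram_matrix hQ₁
  obtain ⟨S₂, hS₂, hev₂, hgr₂⟩ := exists_gram_matrix hQ₂
  obtain ⟨S, hS, hev, hgr⟩ := exists_gram_matrix hQ₃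
  have hn : 2 * (t + 1) ≤ n := by
    have : (2 * (t + 1) : ℚ) ≤ n := by linarith
    exact_mod_cast this
  have hdet : S.det ≠ 0 := by
    intro h0
    obtain ⟨v, hv, hSv⟩ := exists_mulVec_eq_zero_iff.2 h0
    have := (hQ₃ns v hv (by simp [hev, hSv])).ne_zero 0
    simp [hgr, hSv] at this
  obtain ⟨v, hv, hiso⟩ := exists_linearIndependent_isotropic hS (t + 1) (by simpa using hn)
  let E : Matrix (Fin n) (Fin (t + 1)) k := (Matrix.of v)ᵀ
  have hE : Eᵀ * S * E = 0 := by
    ext i j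
    rw [Matrix.mul_assoc]
    exact hiso i j
  have hEinj : Function.Injective E.mulVec := by
    rw [mulVec_injective_iff]
    exact hv
  obtain ⟨Z, hZ, hgood⟩ := exists_cayley_transversal hS hS₁ hS₂ hdet hE (by
    intro x a b μ hx h₁ h₂ h₃ hlin
    have hind := hR x hx (by
      intro i
      fin_cases i
      exacts [(hev₁ x).trans h₁, (hev₂ x).trans h₂, (hev x).trans h₃])
    have := Fintype.linearIndependent_iff.1 hind ![a, b, μ] (by
      simp only [Fin.sum_univ_three, cons_val_zero, cons_val_one, cons_val_two, tail_cons,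
        head_cons, hgr₁, hgr₂, hgr, smul_comm _ (2 : k), ← smul_add, hlin, smul_zero])
    exact ⟨this 0, this 1⟩)
  have hSt : Sᵀ = S := hS
  have hflip := cayley_flip (Z := Z) hSt
  have hflip' := cayley_flip' (Z := Z) hSt
  have hquad := fun x y => cayley_quadratic (x := x) (y := y) (Z := Z) hSt
  have hdet' : (S + (Z - Zᵀ)).det ≠ 0 := by
    rw [← det_transpose, transpose_add, transpose_sub, transpose_transpose, hSt,
      ← neg_sub Z, ← sub_eq_add_neg]
    exact hZ
  generalize S - (Z - Zᵀ) = M at *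
  generalize S + (Z - Zᵀ) = N at *
  have hM : IsUnit M.det := isUnit_iff_ne_zero.2 hZ
  have hN : IsUnit N.det := isUnit_iff_ne_zero.2 hdet'
  let G : (Fin (t + 1) → k) →ₗ[k] (Fin n → k) := (M⁻¹ * N * E).mulVecLin
  have hG : ∀ c, M *ᵥ G c = N *ᵥ (E *ᵥ c) := by
    intro c
    simp only [G, mulVecLin_apply, mulVec_mulVec, ← Matrix.mul_assoc, mul_nonsing_inv _ hM,
      Matrix.one_mul]
  refine ⟨LinearMap.range G, ⟨?_, ?_⟩, isNonsingularSection_of_forall ?_⟩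
  · rw [LinearMap.finrank_range_of_inj, Module.finrank_fin_fun]
    intro c c' hcc
    apply hEinj
    apply mulVec_injective_of_isUnit ((isUnit_iff_isUnit_det _).2 hN)
    rw [← hG, ← hG, hcc]
  · rintro _ ⟨c, rfl⟩
    rw [hev, hquad _ _ (hG c), mulVec_isotropic hE]
  · rintro _ ⟨c, rfl⟩ hx h₁ h₂ a b hab
    rw [hev₁] at h₁
    rw [hev₂] at h₂
    set p := a • S₁ *ᵥ G c + b • S₂ *ᵥ G c with hp
    have hp0 : ∀ c', p ⬝ᵥ G c' = 0 := by
      intro c'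
      have := hab (G c') ⟨c', rfl⟩
      rw [hgr₁, hgr₂, smul_comm a, smul_comm b, ← smul_add, smul_dotProduct, smul_eq_mul] at this
      exact (mul_eq_zero.1 this).resolve_left two_ne_zero
    have hNp : N *ᵥ (N⁻¹ *ᵥ p) = p := by
      rw [mulVec_mulVec, mul_nonsing_inv _ hN, one_mulVec]
    -- Since `Mᵀ = N`, the vector `z = N⁻¹ p` turns `p ⊥ M⁻¹ N (im E)` into `Eᵀ M z = 0`.
    refine hgood c (G c) (N⁻¹ *ᵥ p) a b (hG c) hNp ?_ h₁ h₂ hx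
    rw [← dotProduct_eq_zero_iff]
    intro c'
    rw [mulVec_transpose, ← dotProduct_mulVec, ← hflip', ← hG, hflip, hNp, hp0]
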